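/- Let $\mathcal F$ be the family of non-empty finite subsets of $\mathbb N=\{1,2,\dots\}$. For $\alpha,\beta\in\mathcal F$ write $\alpha<\beta$ if $\max\alpha<\min\beta$. An IP-ring is a set of the form $\mathcal F^{(1)}=\{\bigcup_{i\in\beta}\alpha_i:\beta\in\mathcal F\}$, where $\alpha_1<\alpha_2<\cdots$ is a sequence in $\mathcal F$. For a sequence $(n_i)_{i\ge1}$ of (not necessarily distinct) integers put $n_\alpha=\sum_{i\in\alpha}n_i$ for $\alpha\in\mathcal F$; then $A=\{n_\alpha\}_{\alpha\in\mathcal F}$ is the IP-set generated by $(n_i)$. If $X$ is a compact metric space and $S:X\to X$ is a homeomorphism, then $(X,S)$ is minimal if $X$ has no proper non-empty closed subset invariant under all $S^m$, $m\in\mathbb Z$, and $(X,S)$ is mixing along $\{n_\alpha\}_{\alpha\in\mathcal F}$ if for all non-empty open $U,V\subseteq X$ and every IP-ring $\mathcal F^{(1)}$ there is $\alpha\in\mathcal F^{(1)}$ with $U\cap S^{-n_\alpha}V\neq\emptyset$. An integral polynomial is a polynomial taking integer values at the integers. **Corollary 3.6.** Let $A=\{n_\alpha\}_{\alpha\in\mathcal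 F}$ be an IP-set in $\mathbb Z$, let $d\in\mathbb N$, and let $p_1,\dots,p_d$ be integral polynomials such that no $p_i$ and no $p_i-p_j$ with $i\ne j$ is constant. Let $X$ be a compact metric space and $T:X\to X$ a homeomorphism such that $(X,T)$ is minimal and $(X,T^k)$ is mixing along $\{n_\alpha\}_{\alpha\in\mathcal F}$ for every $k\in\mathbb Z\setminus\{0\}$. Then for every IP-ring $\mathcal F^{(1)}$ there is a dense $G_\delta$ subset $X_0$ of $X$ such that for each $x\in X_0$ the set $$\{(T^{p_1(n_\alpha)}x,\dots,T^{p_d(n_\alpha)}x):\alpha\in\mathcal F^{(1)}\}$$ is dense in $X^d$. -/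

import Mathlib

namespace IPMixing

/-- For finite sets of indices, `α < β` in the sense `max α < min β`. -/
def Before (α β : Finset ℕ) : Prop := ∀ i ∈ α, ∀ j ∈ β, i < j

/-- An IP-ring: the set of all unions `⋃ i ∈ β, a i`, with `β` a non-empty finite set of indices,
for a sequence `a 0 < a 1 < a 2 < ⋯` of non-empty finite sets of indices. -/
def IsIPRing (R : Set (Finset ℕ)) : Prop :=
  ∃ a : ℕ → Finset ℕ, (∀ i, (a i).Nonempty) ∧ (∀ i j, i < j → Before (a i) (a j)) ∧
    R = {γ | ∃ β : Finset ℕ, β.Nonempty ∧ γ = β.biUnion a}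

/-- The element `n_α = ∑ i ∈ α, n i` of the IP-set generated by the sequence `n`. -/
def ipSum (n : ℕ → ℤ) (α : Finset ℕ) : ℤ := ∑ i ∈ α, n i

section Dynamics

variable {X : Type*} [TopologicalSpace X]

/-- `(X, T)` is minimal: the only closed subsets of `X` that are invariant under all integer
powers of `T` are the empty set and `X`. -/
def IsMinimalSystem (T : X ≃ₜ X) : Prop :=
  ∀ K : Set X, IsClosed K → (∀ m : ℤ, ∀ x ∈ K, (T ^ m) x ∈ K) → K = ∅ ∨ K = Set.univ

/-- `(X, T)` is mixing along the IP-set generated by `n`: for all non-empty open `U`, `V` and every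
IP-ring `R` there is `α ∈ R` with `U ∩ T^{-n_α} V ≠ ∅`. -/
def MixingAlong (T : X ≃ₜ X) (n : ℕ → ℤ) : Prop :=
  ∀ U V : Set X, IsOpen U → IsOpen V → U.Nonempty → V.Nonempty →
    ∀ R : Set (Finset ℕ), IsIPRing R →
      ∃ α ∈ R, (U ∩ (T ^ ipSum n α) ⁻¹' V).Nonempty

end Dynamics

/-- An integral polynomial: it takes integer values at the integers. (Such a polynomial has
rational coefficients, which need not be integers.) -/
def IsIntegral (p : Polynomial ℚ) : Prop := ∀ m : ℤ, ∃ k : ℤ, p.eval (m : ℚ) = (k : ℚ)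

/-- The polynomial is constant. -/
def IsConstant (p : Polynomial ℚ) : Prop := ∃ c : ℚ, p = Polynomial.C c

/-- The value at the integer `m`, as an integer. For integral polynomials the floor changes
nothing, see `intValue_eq`. -/
def intValue (p : Polynomial ℚ) (m : ℤ) : ℤ := ⌊p.eval (m : ℚ)⌋

theorem intValue_eq {p : Polynomial ℚ} (hp : IsIntegral p) (m : ℤ) :
    (intValue p m : ℚ) = p.eval (m : ℚ) := by
  obtain ⟨k, hk⟩ := hp m
  simp [intValue, hk]

end IPMixing

/-! By Baire category it suffices to find, for non-empty open U, V_1, ..., V_d, some α in the ring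
and x ∈ U with T^{p_i(n_α)} x ∈ V_i for all i. Times are measured by an idempotent ultrafilter 𝒰 on
ℤ living on the values n_α. Each of its members contains all values over some IP-subring, so mixing
along the IP-set makes every T^k, k ≠ 0, mix at 𝒰-most times (`exists_mixingUltrafilter`).

Polynomial mixing along 𝒰 (`eventually_nonempty_inter`) is a PET induction. By minimality, finitely
many T^{-t}U cover X. If 𝒰-most times were bad, idempotence would give increments κ_t such that m +
κ_t is bad for 𝒰-most m. The polynomials p(x + κ_t) - p(κ_t) - p₁(x), with p₁ of minimal degree,
have smaller weight (`weight_lt`). By induction some m and w satisfy T^{p(m + κ_t) - p₁(m) + t} w ∈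
V_p for all p and t. Some t puts T^{t - p₁(m)} w in U, and this point shows that m + κ_t is good.

A linear p gives the same polynomial for every t, so its constraints must be compatible;
`exists_increments` arranges this by linear mixing. -/

namespace IPMixing

open Polynomial

/-! ### Integral polynomials and their shifts. -/

section Polynomials

theorem IsIntegral.sub {p q : ℚ[X]} (hp : IsIntegral p) (hq : IsIntegral q) :
    IsIntegral (p - q) := by
  intro m
  obtain ⟨a, ha⟩ := hp m
  obtain ⟨b, hb⟩ := hq m
  exact ⟨a - b, by simp [ha, hb]⟩

theorem intValue_sub {p q : ℚ[X]} (hp : IsIntegral p) (hq : IsIntegral q) (m : ℤ) :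
    intValue (p - q) m = intValue p m - intValue q m := by
  have h : ((intValue (p - q) m : ℤ) : ℚ) = ((intValue p m - intValue q m : ℤ) : ℚ) := by
    rw [intValue_eq (hp.sub hq)]
    push_cast
    rw [intValue_eq hp, intValue_eq hq, eval_sub]
  exact_mod_cast h

/-- The polynomial `p (x + k) - p k`. -/
noncomputable def shift (p : ℚ[X]) (k : ℤ) : ℚ[X] := taylor (k : ℚ) p - C (p.eval (k : ℚ))

theorem eval_shift (p : ℚ[X]) (k : ℤ) (x : ℚ) :
    (shift p k).eval x = p.eval (x + k) - p.eval (k : ℚ) := by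
  simp [shift, taylor_eval]

theorem eval_zero_shift (p : ℚ[X]) (k : ℤ) : (shift p k).eval 0 = 0 := by
  simp [eval_shift]

theorem IsIntegral.shift {p : ℚ[X]} (hp : IsIntegral p) (k : ℤ) : IsIntegral (shift p k) := by
  intro m
  obtain ⟨a, ha⟩ := hp (m + k)
  obtain ⟨b, hb⟩ := hp k
  refine ⟨a - b, ?_⟩
  rw [eval_shift]
  push_cast at ha ⊢
  rw [ha, hb]

theorem intValue_shift {p : ℚ[X]} (hp : IsIntegral p) (k m : ℤ) :
    intValue (shift p k) m = intValue p (m + k) - intValue p k := by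
  have h : ((intValue (shift p k) m : ℤ) : ℚ) = ((intValue p (m + k) - intValue p k : ℤ) : ℚ) := by
    rw [intValue_eq (hp.shift k), eval_shift]
    push_cast
    rw [intValue_eq hp, intValue_eq hp]
    push_cast
    rfl
  exact_mod_cast h

theorem natDegree_shift (p : ℚ[X]) (k : ℤ) : (shift p k).natDegree = p.natDegree := by
  rw [shift, natDegree_sub_C, natDegree_taylor]

theorem leadingCoeff_shift {p : ℚ[X]} (hp : 0 < p.natDegree) (k : ℤ) :
    (shift p k).leadingCoeff = p.leadingCoeff := by
  rw [shift, leadingCoeff_sub_of_degree_lt, leadingCoeff_taylor]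
  refine lt_of_le_of_lt degree_C_le ?_
  rw [← natDegree_pos_iff_degree_pos, natDegree_taylor]
  exact hp

theorem natDegree_pos_of_ne_zero {p : ℚ[X]} (h : p ≠ 0) (h0 : p.eval 0 = 0) :
    0 < p.natDegree := by
  rw [Nat.pos_iff_ne_zero]
  intro hd
  rw [eq_C_of_natDegree_eq_zero hd] at h0 h
  simp at h0
  simp [h0] at h

theorem eq_of_shift_eq {p q : ℚ[X]} (hp : p.eval 0 = 0) (hq : q.eval 0 = 0) {k : ℤ}
    (h : shift p k = shift q k) : p = q := by
  have h1 : taylor (k : ℚ) (p - C (p.eval (k : ℚ))) = taylor (k : ℚ) (q - C (q.eval (k : ℚ))) := by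
    simpa [shift] using h
  have h2 := taylor_injective _ h1
  have h3 := congrArg (eval 0) h2
  simp only [eval_sub, eval_C, hp, hq, zero_sub, neg_inj] at h3
  rw [h3] at h2
  exact sub_left_injective h2

theorem eq_C_mul_X_of_natDegree_le_one {p : ℚ[X]} (hd : p.natDegree ≤ 1) (hp : p.eval 0 = 0) :
    p = C (p.eval 1) * X := by
  obtain ⟨a, b, rfl⟩ := exists_eq_X_add_C_of_natDegree_le_one hd
  simp at hp
  simp [hp]

theorem shift_eq_self {p : ℚ[X]} (hd : p.natDegree ≤ 1) (hp : p.eval 0 = 0) (k : ℤ) :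
    shift p k = p := by
  rw [eq_C_mul_X_of_natDegree_le_one hd hp]
  simp [shift, taylor_apply]
  ring

theorem intValue_of_natDegree_le_one {p : ℚ[X]} (hi : IsIntegral p) (hd : p.natDegree ≤ 1)
    (hp : p.eval 0 = 0) (m : ℤ) : intValue p m = intValue p 1 * m := by
  have h : ((intValue p m : ℤ) : ℚ) = ((intValue p 1 * m : ℤ) : ℚ) := by
    push_cast
    rw [intValue_eq hi, intValue_eq hi, eq_C_mul_X_of_natDegree_le_one hd hp]
    simp
  exact_mod_cast h

theorem intValue_one_ne_zero {p : ℚ[X]} (hi : IsIntegral p) (hd : p.natDegree ≤ 1)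
    (hp : p.eval 0 = 0) (h : p ≠ 0) : intValue p 1 ≠ 0 := by
  intro h1
  apply h
  have h2 := intValue_eq hi 1
  rw [h1] at h2
  rw [eq_C_mul_X_of_natDegree_le_one hd hp]
  simp at h2
  simp [← h2]

/-- The coefficient in degree `p.natDegree - 1` is a non-constant affine function of the shift. That
degree is positive, so removing the constant term does not affect it. -/
theorem shift_injective {p : ℚ[X]} (hd : 2 ≤ p.natDegree) : Function.Injective (shift p) := by
  intro k l h
  have hc := congrArg (fun q => coeff q (p.natDegree - 1)) h
  have hne : p.natDegree - 1 ≠ 0 := by omega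
  simp only [shift, coeff_sub, coeff_C, hne, if_false, sub_zero, taylor_coeff] at hc
  have hdeg : (hasseDeriv (p.natDegree - 1) p).natDegree = 1 := by
    rw [natDegree_hasseDeriv]; omega
  obtain ⟨a, b, hab⟩ := exists_eq_X_add_C_of_natDegree_le_one hdeg.le
  have ha : a ≠ 0 := by
    rintro rfl
    rw [hab] at hdeg
    simp at hdeg
  rw [hab] at hc
  simp [ha] at hc
  exact hc

end Polynomials

/-! ### The weight for PET induction. -/

section Weight

/-- The pairs `(degree, leading coefficient)` of the members of a finite set of polynomials. -/
noncomputable def degreeClasses (P : Finset ℚ[X]) : Finset (ℕ × ℚ) :=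
  P.image fun p => (p.natDegree, p.leadingCoeff)

/-- The multiset of the degrees of the classes of polynomials with a common degree and leading
coefficient. -/
noncomputable def weight (P : Finset ℚ[X]) : Multiset ℕ := (degreeClasses P).val.map Prod.fst

theorem mem_degreeClasses {P : Finset ℚ[X]} {c : ℕ × ℚ} :
    c ∈ degreeClasses P ↔ ∃ p ∈ P, p.natDegree = c.1 ∧ p.leadingCoeff = c.2 := by
  simp [degreeClasses, Prod.ext_iff]

/-- Passing to the differences `shift p k - p₁`, with `p₁` of minimal degree, lowers the weight. -/
theorem weight_lt {P Q : Finset ℚ[X]} {p₁ : ℚ[X]} (h₁ : p₁ ∈ P)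
    (hmin : ∀ p ∈ P, p₁.natDegree ≤ p.natDegree) (hpos : 0 < p₁.natDegree)
    (hQ : ∀ q ∈ Q, q ≠ 0 ∧ ∃ p ∈ P, ∃ k, q = shift p k - p₁) :
    Multiset.IsDershowitzMannaLT (weight Q) (weight P) := by
  classical
  set c₁ : ℕ × ℚ := (p₁.natDegree, p₁.leadingCoeff) with hc₁
  have hc₁P : c₁ ∈ degreeClasses P := mem_degreeClasses.2 ⟨p₁, h₁, rfl, rfl⟩
  -- In the degree of `p₁`, subtraction lowers leading coefficients by that of `p₁`; `ψ` undoes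
  -- this. The class of `p₁` is never hit, since there the leading terms cancel.
  let ψ : ℕ × ℚ → ℕ × ℚ := fun c => (c.1, if c.1 = c₁.1 then c.2 + c₁.2 else c.2)
  have hψ : Function.Injective ψ := by
    rintro ⟨d, a⟩ ⟨e, b⟩ h
    simp only [ψ, Prod.mk.injEq] at h
    obtain ⟨rfl, h⟩ := h
    split_ifs at h <;> simpa using h
  let H := (degreeClasses Q).filter fun c => c₁.1 ≤ c.1
  have hH : H.image ψ ⊆ (degreeClasses P).erase c₁ := by
    intro c hc
    obtain ⟨⟨e, b⟩, hb, rfl⟩ := Finset.mem_image.1 hc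
    obtain ⟨hbQ, hle⟩ := Finset.mem_filter.1 hb
    obtain ⟨q, hq, rfl, rfl⟩ := mem_degreeClasses.1 hbQ
    obtain ⟨hq0, p, hp, k, hqe⟩ := hQ q hq
    have hpp : 0 < p.natDegree := hpos.trans_le (hmin p hp)
    have hsn := natDegree_shift p k
    have hsl := leadingCoeff_shift hpp k
    have hlq : q.leadingCoeff ≠ 0 := leadingCoeff_ne_zero.2 hq0
    simp only [hc₁] at hle
    rcases (hmin p hp).lt_or_eq with hlt | heq
    · have hdeg : p₁.degree < (shift p k).degree := by
        apply degree_lt_degree; rw [hsn]; exact hlt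
      have h1 : q.natDegree = p.natDegree := by
        rw [hqe, natDegree_sub_eq_left_of_natDegree_lt (by rw [hsn]; exact hlt), hsn]
      have h2 : q.leadingCoeff = p.leadingCoeff := by
        rw [hqe, leadingCoeff_sub_of_degree_lt hdeg, hsl]
      have hne : p.natDegree ≠ p₁.natDegree := hlt.ne'
      simp only [ψ, hc₁, Finset.mem_erase, h1, h2, ne_eq, Prod.mk.injEq, hne, false_and,
        not_false_eq_true, true_and]
      exact mem_degreeClasses.2 ⟨p, hp, rfl, rfl⟩
    · have hdl : q.natDegree ≤ p₁.natDegree := by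
        rw [hqe]
        refine (natDegree_sub_le _ _).trans ?_
        rw [hsn, ← heq, max_self]
      have hde : q.natDegree = p₁.natDegree := le_antisymm hdl hle
      have h2 : q.leadingCoeff = p.leadingCoeff - p₁.leadingCoeff := by
        rw [leadingCoeff, hde, hqe, coeff_sub, ← hsl, leadingCoeff, leadingCoeff, hsn, heq]
      simp only [ψ, hc₁, Finset.mem_erase, hde, h2, if_true, sub_add_cancel, ne_eq, Prod.mk.injEq,
        true_and]
      refine ⟨fun h => hlq ?_, mem_degreeClasses.2 ⟨p, hp, heq.symm, rfl⟩⟩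
      rw [h2, h, sub_self]
  have hHle : H.val.map Prod.fst ≤ ((degreeClasses P).erase c₁).val.map Prod.fst := by
    have h1 : (H.image ψ).val.map Prod.fst = H.val.map Prod.fst := by
      rw [Finset.image_val_of_injOn hψ.injOn, Multiset.map_map]
      rfl
    rw [← h1]
    exact Multiset.map_le_map (Finset.val_le_iff.2 hH)
  obtain ⟨Z, hZ⟩ := Multiset.le_iff_exists_add.1 hHle
  have hP : weight P = H.val.map Prod.fst + (p₁.natDegree ::ₘ Z) := by
    rw [weight, ← Finset.insert_erase hc₁P, Finset.insert_val_of_notMem (Finset.notMem_erase _ _),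
      Multiset.map_cons, hZ, Multiset.add_cons]
  -- The new classes of lower degree may be numerous, but the removed degree of `p₁` dominates them
  -- all.
  refine ⟨H.val.map Prod.fst, ((degreeClasses Q).filter fun c => ¬ c₁.1 ≤ c.1).val.map Prod.fst,
    p₁.natDegree ::ₘ Z, by simp, ?_, hP, ?_⟩
  · rw [weight, ← Multiset.map_add]
    congr 1
    exact (Multiset.filter_add_not _ _).symm
  · intro y hy
    refine ⟨p₁.natDegree, Multiset.mem_cons_self _ _, ?_⟩
    obtain ⟨c, hc, rfl⟩ := Multiset.mem_map.1 hy
    have := (Finset.mem_filter.1 hc).2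
    simpa [hc₁] using this

end Weight

end IPMixing

namespace IPMixing

open Polynomial Filter

/-! ### Polynomial mixing along an idempotent ultrafilter. -/

section Recurrence

variable {X : Type*} [TopologicalSpace X]

theorem zpow_add_apply (T : X ≃ₜ X) (a b : ℤ) (x : X) : (T ^ (a + b)) x = (T ^ a) ((T ^ b) x) := by
  rw [zpow_add]; rfl

theorem nonempty_zpow_preimage (T : X ≃ₜ X) (a : ℤ) {V : Set X} (hV : V.Nonempty) :
    ((T ^ a) ⁻¹' V).Nonempty :=
  hV.preimage (T ^ a).surjective

theorem isOpen_zpow_preimage (T : X ≃ₜ X) (a : ℤ) {V : Set X} (hV : IsOpen V) :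
    IsOpen ((T ^ a) ⁻¹' V) :=
  hV.preimage (T ^ a).continuous

/-- In a compact minimal system finitely many translates of a non-empty open set cover. -/
theorem IsMinimalSystem.exists_finset_cover [CompactSpace X] {T : X ≃ₜ X} (hT : IsMinimalSystem T)
    {U : Set X} (hU : IsOpen U) (hne : U.Nonempty) :
    ∃ s : Finset ℤ, ∀ x, ∃ t ∈ s, (T ^ t) x ∈ U := by
  have hcov : (⋃ t : ℤ, (T ^ t) ⁻¹' U) = Set.univ := by
    rw [← Set.compl_empty_iff]
    refine (hT _ (isOpen_iUnion fun t => isOpen_zpow_preimage T t hU).isClosed_compl ?_).resolve_right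
      ?_
    · intro m x hx h
      obtain ⟨t, ht⟩ := Set.mem_iUnion.1 h
      refine hx (Set.mem_iUnion.2 ⟨t + m, ?_⟩)
      rw [Set.mem_preimage, zpow_add_apply]
      exact ht
    · intro h
      obtain ⟨x, hx⟩ := hne
      have : x ∈ (⋃ t : ℤ, (T ^ t) ⁻¹' U)ᶜ := h ▸ Set.mem_univ x
      exact this (Set.mem_iUnion.2 ⟨0, by simpa using hx⟩)
  obtain ⟨s, hs⟩ := isCompact_univ.elim_finite_subcover (fun t : ℤ => (T ^ t) ⁻¹' U)
    (fun t => isOpen_zpow_preimage T t hU) hcov.ge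
  refine ⟨s, fun x => ?_⟩
  simpa using hs (Set.mem_univ x)

/-- An ultrafilter on `ℤ` that is idempotent for addition. -/
def IsAddIdempotent (𝒰 : Ultrafilter ℤ) : Prop :=
  ∀ B : Set ℤ, (∀ᶠ m in 𝒰, m ∈ B) → ∀ᶠ k in 𝒰, ∀ᶠ m in 𝒰, m + k ∈ B

/-- All non-trivial powers of `T` are mixing along the ultrafilter `𝒰`. -/
def MixingUltrafilter (T : X ≃ₜ X) (𝒰 : Ultrafilter ℤ) : Prop :=
  ∀ k : ℤ, k ≠ 0 → ∀ U V : Set X, IsOpen U → IsOpen V → U.Nonempty → V.Nonempty →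
    ∀ᶠ m in 𝒰, (U ∩ (T ^ (k * m)) ⁻¹' V).Nonempty

/-- A principal idempotent ultrafilter sits at 0, and at time 0 disjoint open sets do not mix. -/
theorem MixingUltrafilter.eventually_ne [T2Space X] [Nontrivial X] {T : X ≃ₜ X}
    {𝒰 : Ultrafilter ℤ} (h : MixingUltrafilter T 𝒰) (hi : IsAddIdempotent 𝒰) (c : ℤ) :
    ∀ᶠ m in 𝒰, m ≠ c := by
  by_contra hc
  rw [← Ultrafilter.eventually_not] at hc
  replace hc : ∀ᶠ m in 𝒰, m ∈ ({c} : Set ℤ) := by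
    filter_upwards [hc] with m hm
    simpa using hm
  obtain ⟨k, hk, hkc⟩ := ((hi _ hc).and hc).exists
  obtain ⟨m, hm, hmc⟩ := (hk.and hc).exists
  simp only [Set.mem_singleton_iff] at hkc hm hmc
  have hc0 : c = 0 := by omega
  obtain ⟨x, y, hxy⟩ := exists_pair_ne X
  obtain ⟨U, V, hU, hV, hx, hy, hd⟩ := t2_separation hxy
  obtain ⟨l, ⟨z, hzU, hzV⟩, hl⟩ := ((h 1 one_ne_zero U V hU hV ⟨x, hx⟩ ⟨y, hy⟩).and hc).exists
  simp only [Set.mem_singleton_iff] at hl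
  rw [hl, hc0] at hzV
  exact Set.disjoint_left.1 hd hzU (by simpa using hzV)

/-- The choice of the increments: along the increments the linear members of `P` satisfy a common
constraint, and the shifts of the non-linear ones are distinct. -/
theorem exists_increments [Nonempty X] {T : X ≃ₜ X} {𝒰 : Ultrafilter ℤ}
    (hM : MixingUltrafilter T 𝒰) (hne : ∀ c : ℤ, ∀ᶠ m in 𝒰, m ≠ c)
    {P : Finset ℚ[X]} (hint : ∀ p ∈ P, IsIntegral p) (hz : ∀ p ∈ P, p.eval 0 = 0)
    (hP0 : ∀ p ∈ P, p ≠ 0) (V : ℚ[X] → Set X) (hVo : ∀ p ∈ P, IsOpen (V p))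
    (hVn : ∀ p ∈ P, (V p).Nonempty) {G : ℤ → Prop} (hG : ∀ᶠ k in 𝒰, G k) (s : Finset ℤ) :
    ∃ κ : ℤ → ℤ, (∀ t ∈ s, G (κ t)) ∧
      (∀ p ∈ P, p.natDegree ≤ 1 →
        (⋂ t ∈ s, (T ^ (intValue p (κ t) + t)) ⁻¹' V p).Nonempty) ∧
      ∀ p ∈ P, ∀ p' ∈ P, 2 ≤ p.natDegree → 2 ≤ p'.natDegree → ∀ t ∈ s, ∀ t' ∈ s,
        shift p (κ t) = shift p' (κ t') → t = t' := by
  classical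
  induction s using Finset.induction_on with
  | empty => exact ⟨id, by simp, by simp, by simp⟩
  | insert u s hu ih =>
    obtain ⟨κ, hκG, hκL, hκN⟩ := ih
    -- For linear `p`, p(k) = p(1)k, so mixing of T^{p(1)} adds the constraint for `u` to those
    -- already secured.
    have hL : ∀ᶠ k in 𝒰, ∀ p ∈ P, p.natDegree ≤ 1 →
        ((⋂ t ∈ s, (T ^ (intValue p (κ t) + t)) ⁻¹' V p) ∩
          (T ^ (intValue p k + u)) ⁻¹' V p).Nonempty := by
      refine (eventually_all_finset P).2 fun p hp => ?_
      by_cases hd : p.natDegree ≤ 1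
      · have hk := hM (intValue p 1) (intValue_one_ne_zero (hint p hp) hd (hz p hp) (hP0 p hp))
          (⋂ t ∈ s, (T ^ (intValue p (κ t) + t)) ⁻¹' V p) ((T ^ u) ⁻¹' V p)
          (isOpen_biInter_finset fun t _ => isOpen_zpow_preimage T _ (hVo p hp))
          (isOpen_zpow_preimage T _ (hVo p hp)) (hκL p hp hd) (nonempty_zpow_preimage T _ (hVn p hp))
        filter_upwards [hk] with k hk _
        obtain ⟨x, hx, hxV⟩ := hk
        refine ⟨x, hx, ?_⟩
        rw [← intValue_of_natDegree_le_one (hint p hp) hd (hz p hp)] at hxV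
        rw [Set.mem_preimage, add_comm, zpow_add_apply]
        exact hxV
      · exact Eventually.of_forall fun k h => absurd h hd
    -- Each equality of shifts excludes at most one `k`, and 𝒰 avoids single points.
    have hN : ∀ᶠ k in 𝒰, ∀ p ∈ P, ∀ p' ∈ P, ∀ t ∈ s, 2 ≤ p.natDegree →
        shift p k ≠ shift p' (κ t) := by
      refine (eventually_all_finset P).2 fun p _ => (eventually_all_finset P).2 fun p' _ =>
        (eventually_all_finset s).2 fun t _ => ?_
      by_cases hd : 2 ≤ p.natDegree
      · by_cases hex : ∃ c, shift p c = shift p' (κ t)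
        · obtain ⟨c, hc⟩ := hex
          filter_upwards [hne c] with k hk _ h
          exact hk (shift_injective hd (h.trans hc.symm))
        · exact Eventually.of_forall fun k _ h => hex ⟨k, h⟩
      · exact Eventually.of_forall fun k h => absurd h hd
    obtain ⟨k, ⟨hkG, hkL⟩, hkN⟩ := ((hG.and hL).and hN).exists
    have hs : ∀ t ∈ s, Function.update κ u k t = κ t := fun t ht =>
      Function.update_of_ne (ne_of_mem_of_not_mem ht hu) _ _
    refine ⟨Function.update κ u k, ?_, ?_, ?_⟩
    · intro t ht
      rcases Finset.mem_insert.1 ht with rfl | ht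
      · simpa using hkG
      · rw [hs t ht]; exact hκG t ht
    · intro p hp hd
      obtain ⟨x, hx, hxu⟩ := hkL p hp hd
      refine ⟨x, ?_⟩
      rw [Set.mem_iInter₂] at hx ⊢
      intro t ht
      rcases Finset.mem_insert.1 ht with rfl | ht
      · simpa using hxu
      · rw [hs t ht]; exact hx t ht
    · intro p hp p' hp' hd hd' t ht t' ht' h
      rcases Finset.mem_insert.1 ht with htu | hts <;>
        rcases Finset.mem_insert.1 ht' with htu' | hts'
      · rw [htu, htu']
      · rw [htu, hs t' hts', Function.update_self] at h
        exact absurd h (hkN p hp p' hp' t' hts' hd)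
      · rw [htu', hs t hts, Function.update_self] at h
        exact absurd h.symm (hkN p' hp' p hp t hts hd')
      · rw [hs t hts, hs t' hts'] at h
        exact hκN p hp p' hp' hd hd' t hts t' hts' h

/-- Polynomial mixing of all orders along an idempotent ultrafilter, for polynomials vanishing
at `0`. -/
theorem eventually_nonempty_inter [CompactSpace X] {T : X ≃ₜ X} (hT : IsMinimalSystem T)
    {𝒰 : Ultrafilter ℤ} (hi : IsAddIdempotent 𝒰) (hM : MixingUltrafilter T 𝒰)
    (hne : ∀ c : ℤ, ∀ᶠ m in 𝒰, m ≠ c) (P : Finset ℚ[X]) (hint : ∀ p ∈ P, IsIntegral p)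
    (hz : ∀ p ∈ P, p.eval 0 = 0) (hP0 : ∀ p ∈ P, p ≠ 0) (U : Set X) (hU : IsOpen U)
    (hUn : U.Nonempty) (V : ℚ[X] → Set X) (hVo : ∀ p ∈ P, IsOpen (V p))
    (hVn : ∀ p ∈ P, (V p).Nonempty) :
    ∀ᶠ m in 𝒰, ∃ x ∈ U, ∀ p ∈ P, (T ^ intValue p m) x ∈ V p := by
  classical
  induction hw : weight P using
    (Multiset.wellFounded_isDershowitzMannaLT (α := ℕ)).induction generalizing P U V with
  | _ w ih =>
  subst hw
  rcases P.eq_empty_or_nonempty with rfl | hPn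
  · obtain ⟨x, hx⟩ := hUn
    exact Eventually.of_forall fun m => ⟨x, hx, by simp⟩
  have : Nonempty X := hUn.to_type
  obtain ⟨p₁, h₁, hmin⟩ := P.exists_min_image natDegree hPn
  obtain ⟨s, hs⟩ := hT.exists_finset_cover hU hUn
  by_contra hbad
  rw [← Ultrafilter.eventually_not] at hbad
  have hG := hi {m | ¬ ∃ x ∈ U, ∀ p ∈ P, (T ^ intValue p m) x ∈ V p} hbad
  obtain ⟨κ, hκG, hκL, hκN⟩ := exists_increments hM hne hint hz hP0 V hVo hVn hG s
  set D : ℚ[X] → ℤ → Set X := fun p t => (T ^ (intValue p (κ t) + t)) ⁻¹' V p with hD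
  -- Pairs `(p, t)` with the same difference `q` share one target; by `hinj` below this happens only
  -- for a linear `p` and varying `t`.
  set W : ℚ[X] → Set X := fun q => ⋂ p ∈ P, ⋂ t ∈ s, ⋂ _ : shift p (κ t) - p₁ = q, D p t with hW
  have hWo : ∀ q, IsOpen (W q) := fun q =>
    isOpen_biInter_finset fun p hp => isOpen_biInter_finset fun t _ =>
      isOpen_iInter_of_finite fun _ => isOpen_zpow_preimage T _ (hVo p hp)
  have hinj : ∀ p ∈ P, ∀ p' ∈ P, ∀ t ∈ s, ∀ t' ∈ s, shift p (κ t) = shift p' (κ t') →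
      p = p' ∧ (2 ≤ p.natDegree → t = t') := by
    intro p hp p' hp' t ht t' ht' h
    have hdeg : p.natDegree = p'.natDegree := by
      rw [← natDegree_shift p (κ t), h, natDegree_shift]
    by_cases hd : p.natDegree ≤ 1
    · rw [shift_eq_self hd (hz p hp), shift_eq_self (hdeg ▸ hd) (hz p' hp')] at h
      exact ⟨h, fun h2 => by omega⟩
    · have htt := hκN p hp p' hp' (by omega) (by omega) t ht t' ht' h
      subst htt
      exact ⟨eq_of_shift_eq (hz p hp) (hz p' hp') h, fun _ => rfl⟩
  have hWn : ∀ q, (W q).Nonempty := by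
    intro q
    by_cases hex : ∃ p ∈ P, ∃ t ∈ s, shift p (κ t) - p₁ = q
    · obtain ⟨p, hp, t, ht, rfl⟩ := hex
      by_cases hd : p.natDegree ≤ 1
      · obtain ⟨x, hx⟩ := hκL p hp hd
        refine ⟨x, ?_⟩
        simp only [hW, Set.mem_iInter] at hx ⊢
        intro p' hp' t' ht' h
        obtain ⟨rfl, -⟩ := hinj p' hp' p hp t' ht' t ht (sub_left_injective h)
        exact hx t' ht'
      · obtain ⟨x, hx⟩ := nonempty_zpow_preimage T (intValue p (κ t) + t) (hVn p hp)
        refine ⟨x, ?_⟩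
        simp only [hW, Set.mem_iInter]
        intro p' hp' t' ht' h
        obtain ⟨rfl, h2⟩ := hinj p' hp' p hp t' ht' t ht (sub_left_injective h)
        obtain rfl := h2 (by omega)
        exact hx
    · obtain ⟨x⟩ := this
      refine ⟨x, ?_⟩
      simp only [hW, Set.mem_iInter]
      exact fun p hp t ht h => absurd ⟨p, hp, t, ht, h⟩ hex
  -- A zero difference moves nothing: its constraint becomes the set `W 0` from which `w` is taken.
  set Q : Finset ℚ[X] := ((P ×ˢ s).image fun c => shift c.1 (κ c.2) - p₁).erase 0 with hQdef
  have hQ : ∀ q ∈ Q, q ≠ 0 ∧ ∃ p ∈ P, ∃ k, q = shift p k - p₁ := by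
    intro q hq
    obtain ⟨hq0, hq⟩ := Finset.mem_erase.1 hq
    obtain ⟨⟨p, t⟩, hpt, rfl⟩ := Finset.mem_image.1 hq
    exact ⟨hq0, p, (Finset.mem_product.1 hpt).1, κ t, rfl⟩
  have hlt : Multiset.IsDershowitzMannaLT (weight Q) (weight P) :=
    weight_lt h₁ hmin (natDegree_pos_of_ne_zero (hP0 p₁ h₁) (hz p₁ h₁)) hQ
  have hrec := ih _ hlt Q
    (fun q hq => by
      obtain ⟨-, p, hp, k, rfl⟩ := hQ q hq
      exact ((hint p hp).shift k).sub (hint p₁ h₁))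
    (fun q hq => by
      obtain ⟨-, p, hp, k, rfl⟩ := hQ q hq
      rw [eval_sub, eval_zero_shift, hz p₁ h₁, sub_zero])
    (fun q hq => (hQ q hq).1) (W 0) (hWo 0) (hWn 0) W (fun q _ => hWo q) (fun q _ => hWn q) rfl
  have hB : ∀ᶠ m in 𝒰, ∀ t ∈ s, ¬ ∃ x ∈ U, ∀ p ∈ P, (T ^ intValue p (m + κ t)) x ∈ V p :=
    (eventually_all_finset s).2 fun t ht => hκG t ht
  obtain ⟨m, ⟨w, hw0, hwQ⟩, hm⟩ := (hrec.and hB).exists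
  obtain ⟨t, ht, htU⟩ := hs ((T ^ (-intValue p₁ m)) w)
  refine hm t ht ⟨_, htU, fun p hp => ?_⟩
  set q := shift p (κ t) - p₁ with hq
  have hwq : (T ^ intValue q m) w ∈ W q := by
    by_cases hq0 : q = 0
    · rw [hq0]
      simpa [intValue] using hw0
    · exact hwQ q (Finset.mem_erase.2 ⟨hq0, Finset.mem_image.2
        ⟨(p, t), Finset.mem_product.2 ⟨hp, ht⟩, rfl⟩⟩)
  have hDt : (T ^ intValue q m) w ∈ D p t := by
    simp only [hW, Set.mem_iInter] at hwq
    exact hwq p hp t ht rfl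
  rw [hD, Set.mem_preimage, ← zpow_add_apply] at hDt
  rw [← zpow_add_apply, ← zpow_add_apply]
  convert hDt using 3
  rw [hq, intValue_sub ((hint p hp).shift _) (hint p₁ h₁), intValue_shift (hint p hp)]
  ring

end Recurrence

end IPMixing

namespace IPMixing

open Filter

/-! ### Idempotent ultrafilters and IP-rings. -/

section IdempotentUltrafilter

attribute [local instance] Ultrafilter.add Ultrafilter.addSemigroup

theorem ipSum_biUnion (n : ℕ → ℤ) {a : ℕ → Finset ℕ}
    (ha : ∀ i j, i < j → Before (a i) (a j)) (β : Finset ℕ) :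
    ipSum n (β.biUnion a) = ipSum (fun i => ipSum n (a i)) β := by
  refine Finset.sum_biUnion fun i _ j _ hij => ?_
  refine Finset.disjoint_left.2 fun x hx hy => ?_
  rcases hij.lt_or_gt with h | h
  · exact lt_irrefl _ (ha i j h x hx x hy)
  · exact lt_irrefl _ (ha j i h x hy x hx)

/-- The sums `n_α` over non-empty `α` with `min α ≥ N`. -/
def tailSums (n : ℕ → ℤ) (N : ℕ) : Set ℤ :=
  {m | ∃ α : Finset ℕ, α.Nonempty ∧ (∀ i ∈ α, N ≤ i) ∧ m = ipSum n α}

/-- There is an idempotent ultrafilter containing all tails of an IP-set. -/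
theorem exists_isAddIdempotent_tailSums (n : ℕ → ℤ) :
    ∃ 𝒰 : Ultrafilter ℤ, IsAddIdempotent 𝒰 ∧ ∀ N, ∀ᶠ m in 𝒰, m ∈ tailSums n N := by
  let S : Set (Ultrafilter ℤ) := ⋂ N, {𝒰 | ∀ᶠ m in 𝒰, m ∈ tailSums n N}
  obtain ⟨𝒰, h𝒰, hidem⟩ : ∃ 𝒰 ∈ S, 𝒰 + 𝒰 = 𝒰 := by
    -- Ellis's lemma, for the closed subsemigroup of ultrafilters containing every tail.
    refine exists_idempotent_in_compact_add_subsemigroup Ultrafilter.continuous_add_left S ?_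
      (isClosed_iInter fun i => ultrafilter_isClosed_basic _).isCompact ?_
    · refine IsCompact.nonempty_iInter_of_sequence_nonempty_isCompact_isClosed _ ?_ ?_
        (ultrafilter_isClosed_basic _).isCompact fun N => ultrafilter_isClosed_basic _
      · rintro N 𝒰 h
        refine Eventually.mono h ?_
        rintro m ⟨α, hα, hN, rfl⟩
        exact ⟨α, hα, fun i hi => (Nat.le_succ N).trans (hN i hi), rfl⟩
      · intro N
        exact ⟨pure (n N), mem_pure.mpr ⟨{N}, by simp, by simp, by simp [ipSum]⟩⟩
    · intro 𝒰 hU 𝒱 hV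
      simp only [S, Set.mem_iInter, Set.mem_ofPred_eq] at hU hV ⊢
      intro N
      rw [Ultrafilter.eventually_add]
      filter_upwards [hU N] with m hm
      obtain ⟨α, hα, hN, rfl⟩ := hm
      -- Starting beyond `max α` makes `α` and `β` disjoint, so the sums add up.
      filter_upwards [hV (max N (α.sup id + 1))] with m' hm'
      obtain ⟨β, hβ, hM, rfl⟩ := hm'
      refine ⟨α ∪ β, hα.mono Finset.subset_union_left, ?_, ?_⟩
      · intro i hi
        rcases Finset.mem_union.1 hi with hi | hi
        · exact hN i hi
        · exact (le_max_left _ _).trans (hM i hi)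
      · refine (Finset.sum_union (Finset.disjoint_left.2 fun i hi hi' => ?_)).symm
        have h1 : i ≤ α.sup id := Finset.le_sup (f := id) hi
        have h2 := (le_max_right _ _).trans (hM i hi')
        omega
  refine ⟨𝒰, fun B hB => ?_, Set.mem_iInter.1 h𝒰⟩
  rw [← hidem, Ultrafilter.eventually_add] at hB
  simpa only [add_comm] using hB

/-- Every member of an idempotent ultrafilter containing the tails of an IP-set contains the values
of that IP-set on an IP-ring. -/
theorem IsAddIdempotent.exists_blocks {n : ℕ → ℤ} {𝒰 : Ultrafilter ℤ} (hi : IsAddIdempotent 𝒰)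
    (ht : ∀ N, ∀ᶠ m in 𝒰, m ∈ tailSums n N) {A : Set ℤ} (hA : ∀ᶠ m in 𝒰, m ∈ A) :
    ∃ a : ℕ → Finset ℕ, (∀ i, (a i).Nonempty) ∧ (∀ i j, i < j → Before (a i) (a j)) ∧
      ∀ β : Finset ℕ, β.Nonempty → ipSum n (β.biUnion a) ∈ A := by
  have hstep : ∀ c : {B : Set ℤ // ∀ᶠ m in 𝒰, m ∈ B} × ℕ, ∃ α : Finset ℕ, α.Nonempty ∧
      (∀ i ∈ α, c.2 ≤ i) ∧ ipSum n α ∈ c.1.1 ∧ ∀ᶠ m in 𝒰, m + ipSum n α ∈ c.1.1 := by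
    rintro ⟨⟨B, hB⟩, N⟩
    obtain ⟨k, ⟨⟨α, hα, hN, rfl⟩, hkB⟩, hk⟩ := (((ht N).and hB).and (hi B hB)).exists
    exact ⟨α, hα, hN, hkB, hk⟩
  choose f hfn hfN hfA hfs using hstep
  -- Galvin's argument: replace B by B ∩ (B - n_α) and require later blocks to start beyond `max α`.
  let next : {B : Set ℤ // ∀ᶠ m in 𝒰, m ∈ B} × ℕ → {B : Set ℤ // ∀ᶠ m in 𝒰, m ∈ B} × ℕ :=
    fun c => (⟨c.1.1 ∩ {m | m + ipSum n (f c) ∈ c.1.1}, c.1.2.and (hfs c)⟩,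
      max c.2 ((f c).sup id + 1))
  let st : ℕ → {B : Set ℤ // ∀ᶠ m in 𝒰, m ∈ B} × ℕ := fun i => next^[i] (⟨A, hA⟩, 0)
  have hst : ∀ i, st (i + 1) = next (st i) := fun i => Function.iterate_succ_apply' _ _ _
  have hanti : Antitone fun i => (st i).1.1 :=
    antitone_nat_of_succ_le fun i => by
      rw [hst]
      exact Set.inter_subset_left
  have hmono : Monotone fun i => (st i).2 :=
    monotone_nat_of_le_succ fun i => by
      rw [hst]
      exact le_max_left _ _
  have hbefore : ∀ i j, i < j → Before (f (st i)) (f (st j)) := by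
    intro i j hij x hx y hy
    have h1 : x ≤ (f (st i)).sup id := Finset.le_sup (f := id) hx
    have h2 : (f (st i)).sup id + 1 ≤ (st (i + 1)).2 := by
      rw [hst]
      exact le_max_right _ _
    have h3 : (st (i + 1)).2 ≤ (st j).2 := hmono hij
    have h4 := hfN (st j) y hy
    omega
  refine ⟨fun i => f (st i), fun i => hfn _, hbefore, fun β hβ => ?_⟩
  rw [ipSum_biUnion n hbefore]
  -- Peel off the lowest block `i₀`: the remaining sum lies in the set at stage `i₀ + 1`, so adding
  -- the block lands in the set at stage `i₀`.
  have key : ∀ l : ℕ, ∀ β : Finset ℕ, β.card = l → β.Nonempty → ∀ i, (∀ j ∈ β, i ≤ j) →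
      ipSum (fun i => ipSum n (f (st i))) β ∈ (st i).1.1 := by
    intro l
    induction l with
    | zero =>
      intro β h0 hβ
      exact absurd (Finset.card_eq_zero.1 h0) hβ.ne_empty
    | succ l ih =>
      intro β hl hβ i hiβ
      set i₀ := β.min' hβ with hi₀
      have hmem : i₀ ∈ β := β.min'_mem hβ
      refine hanti (hiβ i₀ hmem) ?_
      have hsum : ipSum (fun i => ipSum n (f (st i))) β =
          ipSum (fun i => ipSum n (f (st i))) (β.erase i₀) + ipSum n (f (st i₀)) :=
        (Finset.sum_erase_add _ _ hmem).symm
      rw [hsum]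
      rcases (β.erase i₀).eq_empty_or_nonempty with he | hne
      · rw [he]
        simpa [ipSum] using hfA (st i₀)
      · have h := ih (β.erase i₀) (by rw [Finset.card_erase_of_mem hmem, hl]; rfl) hne (i₀ + 1)
          fun j hj => by
            have := β.min'_le j (Finset.mem_of_mem_erase hj)
            have := Finset.ne_of_mem_erase hj
            omega
        rw [hst] at h
        exact h.2
  exact key _ β rfl hβ 0 fun j _ => Nat.zero_le j

/-- Mixing along an IP-set is mixing along an idempotent ultrafilter that lives on a given
IP-ring. -/
theorem exists_mixingUltrafilter {X : Type*} [TopologicalSpace X] {T : X ≃ₜ X} {n : ℕ → ℤ}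
    (hmix : ∀ k : ℤ, k ≠ 0 → MixingAlong (T ^ k) n) {R : Set (Finset ℕ)} (hR : IsIPRing R) :
    ∃ 𝒰 : Ultrafilter ℤ, IsAddIdempotent 𝒰 ∧ MixingUltrafilter T 𝒰 ∧
      ∀ᶠ m in 𝒰, ∃ α ∈ R, m = ipSum n α := by
  obtain ⟨a, han, hab, rfl⟩ := hR
  obtain ⟨𝒰, hi, ht⟩ := exists_isAddIdempotent_tailSums fun i => ipSum n (a i)
  refine ⟨𝒰, hi, ?_, ?_⟩
  · intro k hk U V hU hV hUn hVn
    by_contra hbad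
    rw [← Ultrafilter.eventually_not] at hbad
    obtain ⟨b, hbn, hbb, hb⟩ := hi.exists_blocks ht
      (A := {m | ¬ (U ∩ (T ^ (k * m)) ⁻¹' V).Nonempty}) hbad
    -- Blocks of blocks generate an IP-subring, on which the bad times would contradict mixing.
    have hring : IsIPRing
        {γ | ∃ β : Finset ℕ, β.Nonempty ∧ γ = β.biUnion fun i => (b i).biUnion a} := by
      refine ⟨fun i => (b i).biUnion a, fun i => (hbn i).biUnion fun j _ => han j, ?_, rfl⟩
      intro i j hij x hx y hy
      obtain ⟨i', hi', hx⟩ := Finset.mem_biUnion.1 hx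
      obtain ⟨j', hj', hy⟩ := Finset.mem_biUnion.1 hy
      exact hab i' j' (hbb i j hij i' hi' j' hj') x hx y hy
    obtain ⟨α, ⟨β, hβ, rfl⟩, hα⟩ := hmix k hk U V hU hV hUn hVn _ hring
    refine hb β hβ ?_
    rw [← ipSum_biUnion n hab, Finset.biUnion_biUnion, zpow_mul]
    exact hα
  · filter_upwards [ht 0] with m hm
    obtain ⟨β, hβ, -, rfl⟩ := hm
    exact ⟨β.biUnion a, ⟨β, hβ, rfl⟩, (ipSum_biUnion n hab β).symm⟩

end IdempotentUltrafilter

/-! ### From mixing to dense orbits. -/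

section Density

open Polynomial

theorem exists_mem_forall_zpow_mem {X : Type*} [TopologicalSpace X] [CompactSpace X] [T2Space X]
    {T : X ≃ₜ X} {n : ℕ → ℤ} {d : ℕ} {p : Fin d → ℚ[X]} (hp : ∀ i, IsIntegral (p i))
    (hconst : ∀ i, ¬ IsConstant (p i)) (hdist : ∀ i j, i ≠ j → ¬ IsConstant (p i - p j))
    (hmin : IsMinimalSystem T) (hmix : ∀ k : ℤ, k ≠ 0 → MixingAlong (T ^ k) n)
    {R : Set (Finset ℕ)} (hR : IsIPRing R) {U : Set X} (hU : IsOpen U) (hUn : U.Nonempty)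
    {V : Fin d → Set X} (hV : ∀ i, IsOpen (V i)) (hVn : ∀ i, (V i).Nonempty) :
    ∃ α ∈ R, ∃ x ∈ U, ∀ i, (T ^ intValue (p i) (ipSum n α)) x ∈ V i := by
  classical
  obtain ⟨𝒰, hi, hM, hmem⟩ := exists_mixingUltrafilter hmix hR
  -- On a single point mixing is vacuous, and 𝒰 may be principal.
  rcases subsingleton_or_nontrivial X with hX | hX
  · obtain ⟨-, α, hα, -⟩ := hmem.exists
    obtain ⟨x, hx⟩ := hUn
    refine ⟨α, hα, x, hx, fun i => ?_⟩
    obtain ⟨y, hy⟩ := hVn i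
    rwa [Subsingleton.elim ((T ^ intValue (p i) (ipSum n α)) x) y]
  -- The value at 0 is moved into the target sets. Non-constant differences make `q` injective, so
  -- targets can be indexed by polynomials; the default `∅` is never used.
  · set q : Fin d → ℚ[X] := fun i => shift (p i) 0 with hq
    have hqe : ∀ i, q i = p i - C ((p i).eval 0) := fun i => by simp [hq, shift]
    have hinj : Function.Injective q := by
      intro i j hij
      by_contra hne
      refine hdist i j hne ⟨(p i).eval 0 - (p j).eval 0, ?_⟩
      rw [hqe, hqe] at hij
      rw [C_sub]
      linear_combination hij
    have hqV : ∀ i, Function.extend q (fun i => (T ^ intValue (p i) 0) ⁻¹' V i)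
        (fun _ => ∅) (q i) = (T ^ intValue (p i) 0) ⁻¹' V i := fun i => hinj.extend_apply _ _ i
    have hev := eventually_nonempty_inter hmin hi hM (hM.eventually_ne hi) (Finset.univ.image q)
      (by simpa using fun i => (hp i).shift 0)
      (by simpa using fun i => eval_zero_shift (p i) 0)
      (by
        simp only [Finset.mem_image, Finset.mem_univ, true_and, forall_exists_index,
          forall_apply_eq_imp_iff]
        intro i h
        rw [hqe, sub_eq_zero] at h
        exact hconst i ⟨_, h⟩) U hU hUn
      (Function.extend q (fun i => (T ^ intValue (p i) 0) ⁻¹' V i) fun _ => ∅)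
      (by
        simp only [Finset.mem_image, Finset.mem_univ, true_and, forall_exists_index,
          forall_apply_eq_imp_iff, hqV]
        exact fun i => isOpen_zpow_preimage T _ (hV i))
      (by
        simp only [Finset.mem_image, Finset.mem_univ, true_and, forall_exists_index,
          forall_apply_eq_imp_iff, hqV]
        exact fun i => nonempty_zpow_preimage T _ (hVn i))
    obtain ⟨m, ⟨x, hxU, hx⟩, α, hα, rfl⟩ := (hev.and hmem).exists
    refine ⟨α, hα, x, hxU, fun i => ?_⟩
    have h := hx (q i) (Finset.mem_image_of_mem q (Finset.mem_univ i))
    rw [hqV, Set.mem_preimage, ← zpow_add_apply, hq, intValue_shift (hp i), add_zero,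
      add_sub_cancel] at h
    exact h

end Density

end IPMixing

theorem corollary3p6 {X : Type*} [MetricSpace X] [CompactSpace X] (T : X ≃ₜ X)
    (n : ℕ → ℤ) (d : ℕ) (p : Fin d → Polynomial ℚ)
    (hp : ∀ i, IPMixing.IsIntegral (p i))
    (hconst : ∀ i, ¬ IPMixing.IsConstant (p i))
    (hdist : ∀ i j, i ≠ j → ¬ IPMixing.IsConstant (p i - p j))
    (hmin : IPMixing.IsMinimalSystem T)
    (hmix : ∀ k : ℤ, k ≠ 0 → IPMixing.MixingAlong (T ^ k) n) :
    ∀ R : Set (Finset ℕ), IPMixing.IsIPRing R →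
      ∃ X₀ : Set X, IsGδ X₀ ∧ Dense X₀ ∧
        ∀ x ∈ X₀, Dense {y : Fin d → X | ∃ α ∈ R,
          y = fun i => (T ^ IPMixing.intValue (p i) (IPMixing.ipSum n α)) x} := by
  intro R hR
  let orbit : Finset ℕ → X → Fin d → X :=
    fun α x i => (T ^ IPMixing.intValue (p i) (IPMixing.ipSum n α)) x
  have horbit : ∀ α, Continuous (orbit α) := fun α =>
    continuous_pi fun i => (T ^ IPMixing.intValue (p i) (IPMixing.ipSum n α)).continuous
  let 𝓑 := TopologicalSpace.countableBasis (Fin d → X)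
  have h𝓑 : 𝓑.Countable := TopologicalSpace.countable_countableBasis _
  have hbasis := TopologicalSpace.isBasis_countableBasis (Fin d → X)
  let G : Set (Fin d → X) → Set X := fun O => ⋃ α ∈ R, orbit α ⁻¹' O
  have hGo : ∀ O ∈ 𝓑, IsOpen (G O) := fun O hO =>
    isOpen_biUnion fun α _ => (hbasis.isOpen hO).preimage (horbit α)
  have hGd : ∀ O ∈ 𝓑, Dense (G O) := by
    intro O hO
    rw [dense_iff_inter_open]
    intro U hU hUn
    obtain ⟨y, hy⟩ := TopologicalSpace.nonempty_of_mem_countableBasis hO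
    obtain ⟨V, hV, hVO⟩ := isOpen_pi_iff'.1 (hbasis.isOpen hO) y hy
    obtain ⟨α, hα, x, hxU, hx⟩ := IPMixing.exists_mem_forall_zpow_mem hp hconst hdist hmin hmix hR
      hU hUn (fun i => (hV i).1) fun i => ⟨y i, (hV i).2⟩
    exact ⟨x, hxU, Set.mem_biUnion hα (hVO fun i _ => hx i)⟩
  refine ⟨⋂ O ∈ 𝓑, G O, IsGδ.biInter h𝓑 fun O hO => (hGo O hO).isGδ,
    dense_biInter_of_isOpen hGo h𝓑 hGd, fun x hx => ?_⟩
  rw [hbasis.dense_iff]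
  intro O hO _
  obtain ⟨α, hα, hxO⟩ := Set.mem_iUnion₂.1 (Set.mem_iInter₂.1 hx O hO)
  exact ⟨orbit α x, hxO, α, hα, rfl⟩
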